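/- Let $G$ be a graph. In the game of \emph{Surrounding Cops and Robbers} with $m>0$ cops, the cops first choose starting vertices of $G$, then the robber chooses a starting vertex not occupied by a cop, and thereafter the cops and the robber alternate turns, the cops first. In a turn each player concerned moves to an adjacent vertex or passes; several cops may share a vertex, but the robber may neither move to nor stay at a vertex occupied by a cop (so if a cop moves onto the robber's vertex, the robber must move at once to a neighbouring vertex without a cop). All positions are known to all players. The cops win if at any time every neighbour of the robber's vertex is occupied by a cop; the robber wins if he avoids this forever. The \emph{surrounding cop number} $\sigma(G)$ is the least $m>0$ such that $m$ cops have a winning strategy on $G$. For positive integers $n,k$ with $n>2k$, the \emph{generalised Petersen graph} $\mathrm{GP}(n,k)$ has vertex set $\{a_0,\dots,a_{n-1}\}\cup\{b_0,\dots,b_{n-1}\}$ and edges $\{a_i,a_{i+1}\}$, $\{a_i,b_i\}$, $\{b_i,b_{i+k}\}$ for $0\le i\le n-1$, with subscripts modulo $n$. \textbf{Theorem.} For all integers $n\ge 5$ and $k\ge 2$ with $n>2k$, $\sigma(\mathrm{GP}(n,k))\le 4$. -/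

import Mathlib

/-!  The game of Surrounding Cops and Robbers, and generalised Petersen graphs.

The cops choose their starting vertices, the robber then chooses a starting vertex that is not
occupied by a cop, and thereafter cops and robber alternate moves, the cops first. -/

namespace SurroundingCops

variable {V : Type*}

/-- A player may pass or move along an edge. -/
def IsMove (G : SimpleGraph V) (u v : V) : Prop :=
  v = u ∨ G.Adj u v

/-- The robber on `r` is surrounded by the cops `c`: every neighbour of `r` holds a cop. -/
def Surrounded (G : SimpleGraph V) {m : ℕ} (c : Fin m → V) (r : V) : Prop :=
  ∀ v, G.Adj r v → ∃ i, c i = v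

/-- A strategy for `m` cops. Given the list of all positions that the robber has taken so far
(the most recent one first), it says where the cops stand next; the empty list gives their
starting positions. In every round each cop passes or moves along an edge. -/
structure CopStrategy (G : SimpleGraph V) (m : ℕ) where
  pos : List V → Fin m → V
  isMove : ∀ (h : List V) (v : V) (i : Fin m), IsMove G (pos h i) (pos (v :: h) i)

/-- The first `t` positions `r 0, …, r (t - 1)` of the robber, the most recent one first. -/
def history (r : ℕ → V) : ℕ → List V
  | 0 => []
  | t + 1 => r t :: history r t

/-- The positions of the cops after they have moved `t` times, if they follow the strategy `s`
and the robber takes the positions `r 0, r 1, …`. -/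
def CopStrategy.copsAt {G : SimpleGraph V} {m : ℕ} (s : CopStrategy G m) (r : ℕ → V) (t : ℕ) :
    Fin m → V :=
  s.pos (history r t)

/-- The robber positions `r 0, r 1, …` respect the rules against the strategy `s`: the robber
starts on a vertex without a cop; in each later turn he passes or moves along an edge, but he may
neither move to nor stay at a vertex that is occupied by a cop. (In particular he has to move away
if a cop has just moved onto his vertex.) -/
def IsRobberPlay {G : SimpleGraph V} {m : ℕ} (s : CopStrategy G m) (r : ℕ → V) : Prop :=
  (∀ t, IsMove G (r t) (r (t + 1))) ∧ ∀ t i, s.copsAt r t i ≠ r t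

/-- The strategy `s` is winning: no robber evades it forever. Each play has a moment at which the
robber is surrounded, after a turn of the robber (or his initial placement) or after a turn of the
cops. (A robber who has no legal move is surrounded, so only infinite plays need be considered.) -/
def CopStrategy.IsWinning {G : SimpleGraph V} {m : ℕ} (s : CopStrategy G m) : Prop :=
  ∀ r : ℕ → V, IsRobberPlay s r →
    ∃ t, Surrounded G (s.copsAt r t) (r t) ∨ Surrounded G (s.copsAt r (t + 1)) (r t)

/-- The surrounding cop number `σ(G)`: the least positive number of cops that have a winning
strategy on `G` (and `⊤` if there is no such number). -/
noncomputable def surroundingCopNumber (G : SimpleGraph V) : ℕ∞ :=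
  ⨅ (m : ℕ) (_ : 0 < m ∧ ∃ s : CopStrategy G m, s.IsWinning), (m : ℕ∞)

end SurroundingCops

/-- The edges of a generalised Petersen graph, each in one orientation; `Sum.inl i` is the vertex
`a_i` and `Sum.inr i` is the vertex `b_i`. -/
def generalizedPetersenArc (n k : ℕ) : ZMod n ⊕ ZMod n → ZMod n ⊕ ZMod n → Prop
  | Sum.inl i, Sum.inl j => j = i + 1
  | Sum.inl i, Sum.inr j => j = i
  | Sum.inr i, Sum.inr j => j = i + (k : ZMod n)
  | Sum.inr _, Sum.inl _ => False

/-- The generalised Petersen graph `GP(n, k)` (meant for `0 < k` and `2 * k < n`). -/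
def generalizedPetersen (n k : ℕ) : SimpleGraph (ZMod n ⊕ ZMod n) :=
  SimpleGraph.fromRel (generalizedPetersenArc n k)

/-! A vertex has a type (outer or inner) and a position in `ZMod n`; type `τ` allows steps `± g τ`,
and a spoke changes the type. A cop of the robber's type can copy his moves and so keep a constant
displacement from him. If two cops have displacements that are multiples of the same `g β`, read one
as ahead and the other as behind: whenever the robber steps along `g β`, the cop he approaches waits
and the other follows, so the gap shrinks. The robber is thus confined to a single coset of `g
(!β)`, where the other two cops close in on him until he is surrounded or the gap shrinks again
(`guardsWin`). To get there, two cops work as a pair, ahead and behind in both generators, until one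
displacement is a multiple of a generator (`copsWin_of_pair`). Repeating this leaves at most one cop
off the axes, and among three cops on two axes two share an axis (`copsWin_of_sync`). -/

namespace SurroundingCops

variable {V : Type*}

/-! ### From winning positions to strategies. -/

/-- The cops, standing on `c`, win against a robber on `r` who is about to move. -/
inductive CopsWin (G : SimpleGraph V) {m : ℕ} : (Fin m → V) → V → Prop
  | surrounded {c : Fin m → V} {r : V} (h : Surrounded G c r) : CopsWin G c r
  | answer {c : Fin m → V} {r : V} (f : V → Fin m → V)
      (hf : ∀ r', IsMove G r r' → (∀ i, c i ≠ r') → ∀ i, IsMove G (c i) (f r' i))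
      (h : ∀ r', IsMove G r r' → (∀ i, c i ≠ r') → CopsWin G (f r') r') : CopsWin G c r

theorem CopsWin.step {G : SimpleGraph V} {m : ℕ} {c : Fin m → V} {r : V}
    (h : ∀ r', IsMove G r r' → (∀ i, c i ≠ r') →
      ∃ c' : Fin m → V, (∀ i, IsMove G (c i) (c' i)) ∧ CopsWin G c' r') : CopsWin G c r := by
  choose! f hf using h
  exact .answer f (fun r' h₁ h₂ => (hf r' h₁ h₂).1) fun r' h₁ h₂ => (hf r' h₁ h₂).2

theorem IsMove.of_eq (G : SimpleGraph V) {u v : V} (h : v = u) : IsMove G u v := Or.inl h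

theorem IsMove.refl (G : SimpleGraph V) (u : V) : IsMove G u u := Or.inl rfl

theorem CopsWin.of_comp_perm {G : SimpleGraph V} {m : ℕ} (σ : Equiv.Perm (Fin m))
    {c : Fin m → V} {r : V} (h : CopsWin G (c ∘ σ) r) : CopsWin G c r := by
  generalize hd : c ∘ σ = d at h
  induction h generalizing c with
  | @surrounded d r h =>
    subst hd
    refine .surrounded fun v hv => ?_
    obtain ⟨i, hi⟩ := h v hv
    exact ⟨σ i, hi⟩
  | @answer d r f hf _ ih =>
    subst hd
    refine .step fun r' hr' hc => ⟨f r' ∘ σ.symm, fun i => ?_, ih r' hr' (fun i => hc (σ i)) ?_⟩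
    · simpa using hf r' hr' (fun i => hc (σ i)) (σ.symm i)
    · ext i
      simp

/-- The first `t` terms of a sequence, the oldest one first. -/
def chronicle (r : ℕ → V) : ℕ → List V
  | 0 => []
  | t + 1 => r 0 :: chronicle (fun j => r (j + 1)) t

theorem chronicle_succ (r : ℕ → V) (t : ℕ) : chronicle r (t + 1) = chronicle r t ++ [r t] := by
  induction t generalizing r with
  | zero => rfl
  | succ t ih =>
    rw [chronicle, ih, chronicle]
    rfl

theorem reverse_history (r : ℕ → V) (t : ℕ) : (history r t).reverse = chronicle r t := by
  induction t with
  | zero => rfl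
  | succ t ih => rw [chronicle_succ, history, List.reverse_cons, ih]

/-- Responses to the moves of the robber, listed with the oldest one first, which win from the
position in which the cops stand on `c` and the robber, on `r₀`, is about to move. -/
def IsWinningResponse (G : SimpleGraph V) {m : ℕ} (c : Fin m → V) (r₀ : V)
    (f : List V → Fin m → V) : Prop :=
  f [] = c ∧ (∀ l v i, IsMove G (f l i) (f (l ++ [v]) i)) ∧
    ∀ r : ℕ → V, r 0 = r₀ → (∀ t, IsMove G (r t) (r (t + 1))) →
      (∀ t i, f (chronicle (fun j => r (j + 1)) t) i ≠ r (t + 1)) →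
      ∃ t, Surrounded G (f (chronicle (fun j => r (j + 1)) t)) (r t)

/-- The robber's first move selects which inductively obtained response handles the rest of the
list; hence the oldest-first order. -/
theorem CopsWin.exists_isWinningResponse {G : SimpleGraph V} {m : ℕ} {c : Fin m → V} {r₀ : V}
    (h : CopsWin G c r₀) : ∃ f, IsWinningResponse G c r₀ f := by
  classical
  induction h with
  | @surrounded c r₀ h =>
    exact ⟨fun _ => c, rfl, fun _ _ _ => .refl _ _, fun r hr _ _ => ⟨0, hr ▸ h⟩⟩
  | @answer c r₀ a ha _ ih =>
    -- A strategy must also obey the movement rule on illegal robber moves; there the cops stay on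
    -- `c`.
    have key : ∀ r', ∃ f : List V → Fin m → V, (∀ i, IsMove G (c i) (f [] i)) ∧
        (∀ l v i, IsMove G (f l i) (f (l ++ [v]) i)) ∧
        (IsMove G r₀ r' → (∀ i, c i ≠ r') → IsWinningResponse G (f []) r' f) := by
      intro r'
      by_cases hr : IsMove G r₀ r' ∧ ∀ i, c i ≠ r'
      · obtain ⟨f, hf⟩ := ih r' hr.1 hr.2
        refine ⟨f, ?_, hf.2.1, fun _ _ => ⟨rfl, hf.2⟩⟩
        rw [hf.1]
        exact ha r' hr.1 hr.2
      · exact ⟨fun _ => c, fun _ => .refl _ _, fun _ _ _ => .refl _ _,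
          fun h₁ h₂ => absurd ⟨h₁, h₂⟩ hr⟩
    choose F hF₀ hF₁ hF₂ using key
    let f : List V → Fin m → V := fun l => match l with
      | [] => c
      | v :: l => F v l
    refine ⟨f, rfl, fun l v i => ?_, fun r hr hm hs => ?_⟩
    · cases l with
      | nil => exact hF₀ v i
      | cons w l => exact hF₁ w l v i
    · have h₀ := hm 0
      rw [hr] at h₀
      obtain ⟨t, ht⟩ := (hF₂ (r 1) h₀ (hs 0)).2.2 (fun j => r (j + 1)) rfl
        (fun t => hm (t + 1)) (fun t => hs (t + 1))
      exact ⟨t + 1, ht⟩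

theorem exists_isWinning {G : SimpleGraph V} {m : ℕ} (c₀ : Fin m → V)
    (h : ∀ r₀, ∃ c, (∀ i, IsMove G (c₀ i) (c i)) ∧ CopsWin G c r₀) :
    ∃ s : CopStrategy G m, s.IsWinning := by
  choose c hc hw using h
  choose F hF₀ hF₁ hF₂ using fun r₀ => (hw r₀).exists_isWinningResponse
  let f : List V → Fin m → V := fun l => match l with
    | [] => c₀
    | v :: l => F v l
  refine ⟨⟨fun l => f l.reverse, fun l v i => ?_⟩, fun r hr => ?_⟩
  · rw [List.reverse_cons]
    cases l.reverse with
    | nil =>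
      change IsMove G (c₀ i) (F v [] i)
      rw [hF₀]
      exact hc v i
    | cons w l => exact hF₁ w l v i
  · have hs : ∀ t i, F (r 0) (chronicle (fun j => r (j + 1)) t) i ≠ r (t + 1) := by
      intro t i
      have := hr.2 (t + 1) i
      dsimp only [CopStrategy.copsAt] at this
      rwa [reverse_history] at this
    obtain ⟨t, ht⟩ := hF₂ (r 0) r rfl hr.1 hs
    refine ⟨t, .inr ?_⟩
    dsimp only [CopStrategy.copsAt]
    rwa [reverse_history]

/-! ### An abstraction symmetric in the two vertex types. -/

/-- The vertices of `G` are the `P τ x`, where `P τ x` is adjacent to `P τ (x ± g τ)` and to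
`P (!τ) x` only; the group is generated by the two elements `g τ`. -/
structure IsBicirculant {A : Type*} [AddCommGroup A] (G : SimpleGraph V) (g : Bool → A)
    (P : Bool → A → V) : Prop where
  surj : ∀ v, ∃ τ x, v = P τ x
  move_add : ∀ τ x, IsMove G (P τ x) (P τ (x + g τ))
  move_sub : ∀ τ x, IsMove G (P τ x) (P τ (x - g τ))
  move_not : ∀ τ x, IsMove G (P τ x) (P (!τ) x)
  adj : ∀ τ x v, G.Adj (P τ x) v → v = P τ (x + g τ) ∨ v = P τ (x - g τ) ∨ v = P (!τ) x
  span : ∀ x : A, ∃ u v : ℕ, x = u • g true + v • g false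

namespace IsBicirculant

variable {A : Type*} [AddCommGroup A] {G : SimpleGraph V} {g : Bool → A} {P : Bool → A → V}

theorem span' (hG : IsBicirculant G g P) (τ : Bool) (x : A) :
    ∃ u v : ℕ, x = u • g τ + v • g (!τ) := by
  obtain ⟨u, v, rfl⟩ := hG.span x
  cases τ
  · exact ⟨v, u, add_comm _ _⟩
  · exact ⟨u, v, rfl⟩

theorem isMove_add (hG : IsBicirculant G g P) {τ : Bool} {x y : A} (h : y = x + g τ) :
    IsMove G (P τ x) (P τ y) := by
  subst h
  exact hG.move_add _ _

theorem isMove_sub (hG : IsBicirculant G g P) {τ : Bool} {x y : A} (h : y = x - g τ) :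
    IsMove G (P τ x) (P τ y) := by
  subst h
  exact hG.move_sub _ _

theorem isMove_not (hG : IsBicirculant G g P) {τ : Bool} {x y : A} (h : y = x) :
    IsMove G (P τ x) (P (!τ) y) := by
  subst h
  exact hG.move_not _ _

theorem isMove_not' (hG : IsBicirculant G g P) {τ : Bool} {x y : A} (h : y = x) :
    IsMove G (P (!τ) x) (P τ y) := by
  simpa using hG.isMove_not (τ := !τ) h

variable {m : ℕ}

theorem surrounded (hG : IsBicirculant G g P) {c : Fin m → V} {τ : Bool} {x : A} (i j l : Fin m)
    (hi : c i = P τ (x + g τ)) (hj : c j = P τ (x - g τ)) (hl : c l = P (!τ) x) :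
    Surrounded G c (P τ x) := by
  intro v hv
  rcases hG.adj τ x v hv with rfl | rfl | rfl
  exacts [⟨i, hi⟩, ⟨j, hj⟩, ⟨l, hl⟩]

theorem copsWin_step (hG : IsBicirculant G g P) {c : Fin m → V} {τ : Bool} {x : A}
    (pass : ∃ c' : Fin m → V, (∀ i, IsMove G (c i) (c' i)) ∧ CopsWin G c' (P τ x))
    (plus : (∀ i, c i ≠ P τ (x + g τ)) →
      ∃ c' : Fin m → V, (∀ i, IsMove G (c i) (c' i)) ∧ CopsWin G c' (P τ (x + g τ)))
    (minus : (∀ i, c i ≠ P τ (x - g τ)) →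
      ∃ c' : Fin m → V, (∀ i, IsMove G (c i) (c' i)) ∧ CopsWin G c' (P τ (x - g τ)))
    (spoke : ∃ c' : Fin m → V, (∀ i, IsMove G (c i) (c' i)) ∧ CopsWin G c' (P (!τ) x)) :
    CopsWin G c (P τ x) := by
  refine .step fun r' hr' hc => ?_
  rcases hr' with rfl | hr'
  · exact pass
  · rcases hG.adj τ x r' hr' with rfl | rfl | rfl
    exacts [plus hc, minus hc, spoke]

theorem isMove_vec {a b c d a' b' c' d' : V} (ha : IsMove G a a') (hb : IsMove G b b')
    (hc : IsMove G c c') (hd : IsMove G d d') (i : Fin 4) :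
    IsMove G (![a, b, c, d] i) (![a', b', c', d'] i) := by
  fin_cases i <;> assumption

/-! ### Two guards on one axis. -/

/-- Two cops who have the type of the robber, and stand `p` steps of type `β` ahead of him and `q`
steps behind him, win together with two further cops, wherever these are. -/
def GuardsWin (G : SimpleGraph V) (g : Bool → A) (P : Bool → A → V) (β : Bool) (p q : ℕ) : Prop :=
  ∀ τ x c d, CopsWin G ![P τ (x + p • g β), P τ (x - q • g β), c, d] (P τ x)

/-- A robber step along `g β` lowers `p + q`, so `ih` wins with `c` and `d` idle. The guards copy
every other move, and only those moves need answers from `c` and `d`. -/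
theorem copsWin_of_row (hG : IsBicirculant G g P) {β : Bool} {p q : ℕ} (hp : 1 ≤ p) (hq : 1 ≤ q)
    (ih : ∀ p' q', 1 ≤ p' → 1 ≤ q' → p' + q' < p + q → GuardsWin G g P β p' q')
    {τ : Bool} {x : A} {c d : V}
    (pass : ∃ c' d', IsMove G c c' ∧ IsMove G d d' ∧
      CopsWin G ![P τ (x + p • g β), P τ (x - q • g β), c', d'] (P τ x))
    (plus : τ = !β → c ≠ P τ (x + g τ) → ∃ c' d', IsMove G c c' ∧ IsMove G d d' ∧
      CopsWin G ![P τ (x + g τ + p • g β), P τ (x + g τ - q • g β), c', d'] (P τ (x + g τ)))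
    (minus : τ = !β → d ≠ P τ (x - g τ) → ∃ c' d', IsMove G c c' ∧ IsMove G d d' ∧
      CopsWin G ![P τ (x - g τ + p • g β), P τ (x - g τ - q • g β), c', d'] (P τ (x - g τ)))
    (spoke : ∃ c' d', IsMove G c c' ∧ IsMove G d d' ∧
      CopsWin G ![P (!τ) (x + p • g β), P (!τ) (x - q • g β), c', d'] (P (!τ) x)) :
    CopsWin G ![P τ (x + p • g β), P τ (x - q • g β), c, d] (P τ x) := by
  refine hG.copsWin_step ?_ (fun h => ?_) (fun h => ?_) ?_
  · obtain ⟨c', d', hc, hd, hw⟩ := pass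
    exact ⟨_, isMove_vec (.refl _ _) (.refl _ _) hc hd, hw⟩
  · rcases Bool.eq_or_eq_not τ β with rfl | hτ
    · obtain ⟨p, rfl⟩ : ∃ p', p = p' + 1 := ⟨p - 1, by omega⟩
      have hp' : p ≠ 0 := by
        -- At distance one the guard occupies the robber's target, so the move was illegal.
        rintro rfl
        exact h 0 (by simp)
      refine ⟨_, isMove_vec (.of_eq _ (congrArg _ ?_)) (hG.isMove_add ?_) (.refl _ c) (.refl _ d),
        ih p q (by omega) hq (by omega) τ _ c d⟩ <;> module
    · obtain ⟨c', d', hc, hd, hw⟩ := plus hτ (h 2)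
      refine ⟨_, isMove_vec (hG.isMove_add ?_) (hG.isMove_add ?_) hc hd, hw⟩ <;> module
  · rcases Bool.eq_or_eq_not τ β with rfl | hτ
    · obtain ⟨q, rfl⟩ : ∃ q', q = q' + 1 := ⟨q - 1, by omega⟩
      have hq' : q ≠ 0 := by
        rintro rfl
        exact h 1 (by simp)
      refine ⟨_, isMove_vec (hG.isMove_sub ?_) (.of_eq _ (congrArg _ ?_)) (.refl _ c) (.refl _ d),
        ih p q hp (by omega) (by omega) τ _ c d⟩ <;> module
    · obtain ⟨c', d', hc, hd, hw⟩ := minus hτ (h 3)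
      refine ⟨_, isMove_vec (hG.isMove_sub ?_) (hG.isMove_sub ?_) hc hd, hw⟩ <;> module
  · obtain ⟨c', d', hc, hd, hw⟩ := spoke
    exact ⟨_, isMove_vec (hG.isMove_not rfl) (hG.isMove_not rfl) hc hd, hw⟩

/-- The other two cops block both neighbours of the robber in his row, while the guards wait in
the vertices of type `β`. -/
theorem copsWin_of_blocked (hG : IsBicirculant G g P) {β : Bool} {p q : ℕ} (hp : 1 ≤ p)
    (hq : 1 ≤ q)
    (ih : ∀ p' q', 1 ≤ p' → 1 ≤ q' → p' + q' < p + q → GuardsWin G g P β p' q')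
    (τ : Bool) (x : A) :
    CopsWin G ![P β (x + p • g β), P β (x - q • g β), P (!β) (x + g (!β)), P (!β) (x - g (!β))]
      (P τ x) := by
  induction hN : p + q using Nat.strong_induction_on generalizing p q τ with
  | _ N IH =>
  subst hN
  have closer : 3 ≤ p + q → ∃ p' q', 1 ≤ p' ∧ 1 ≤ q' ∧ p' + q' < p + q ∧
      IsMove G (P β (x + p • g β)) (P β (x + p' • g β)) ∧
      IsMove G (P β (x - q • g β)) (P β (x - q' • g β)) := by
    intro h
    by_cases hp' : 2 ≤ p
    · obtain ⟨p, rfl⟩ : ∃ p', p = p' + 1 := ⟨p - 1, by omega⟩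
      refine ⟨p, q, by omega, hq, by omega, hG.isMove_sub ?_, .refl _ _⟩
      module
    · obtain ⟨q, rfl⟩ : ∃ q', q = q' + 1 := ⟨q - 1, by omega⟩
      refine ⟨p, q, hp, by omega, by omega, .refl _ _, hG.isMove_add ?_⟩
      module
  have inner : ∃ c' : Fin 4 → V, (∀ i, IsMove G (![P β (x + p • g β), P β (x - q • g β),
      P (!β) (x + g (!β)), P (!β) (x - g (!β))] i) (c' i)) ∧ CopsWin G c' (P β x) := by
    by_cases h : 3 ≤ p + q
    · obtain ⟨p', q', hp', hq', hlt, h₁, h₂⟩ := closer h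
      exact ⟨_, isMove_vec h₁ h₂ (.refl _ _) (.refl _ _), ih p' q' hp' hq' hlt β x _ _⟩
    · obtain rfl : p = 1 := by omega
      obtain rfl : q = 1 := by omega
      -- The guards are adjacent to the robber; a blocker steps onto the end of his spoke.
      refine ⟨![P β (x + g β), P β (x - g β), P (!β) x, P (!β) (x - g (!β))],
        isMove_vec (.of_eq _ (by simp)) (.of_eq _ (by simp)) (hG.isMove_sub ?_) (.refl _ _),
        .surrounded (hG.surrounded 0 1 2 rfl rfl rfl)⟩
      module
  have outer : ∃ c' : Fin 4 → V, (∀ i, IsMove G (![P β (x + p • g β), P β (x - q • g β),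
      P (!β) (x + g (!β)), P (!β) (x - g (!β))] i) (c' i)) ∧ CopsWin G c' (P (!β) x) := by
    by_cases h : 3 ≤ p + q
    · obtain ⟨p', q', hp', hq', hlt, h₁, h₂⟩ := closer h
      exact ⟨_, isMove_vec h₁ h₂ (.refl _ _) (.refl _ _), IH _ hlt hp' hq'
        (fun p'' q'' h₁ h₂ h₃ => ih p'' q'' h₁ h₂ (h₃.trans hlt)) (!β) rfl⟩
    · obtain rfl : p = 1 := by omega
      obtain rfl : q = 1 := by omega
      -- The blockers hold the robber's row, so a guard closes the spoke.
      refine ⟨![P β x, P β (x - g β), P (!β) (x + g (!β)), P (!β) (x - g (!β))],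
        isMove_vec (hG.isMove_sub ?_) (.of_eq _ (by simp)) (.refl _ _) (.refl _ _),
        .surrounded (hG.surrounded 2 3 0 rfl rfl (by simp))⟩
      module
  rcases Bool.eq_or_eq_not τ β with rfl | rfl
  · refine hG.copsWin_step inner (fun h => ?_) (fun h => ?_) outer
    · obtain ⟨p, rfl⟩ : ∃ p', p = p' + 1 := ⟨p - 1, by omega⟩
      have hp' : p ≠ 0 := by
        rintro rfl
        exact h 0 (by simp)
      refine ⟨_, isMove_vec (.of_eq _ (congrArg _ ?_)) (hG.isMove_add ?_) (.refl _ _) (.refl _ _),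
        ih p q (by omega) hq (by omega) τ _ _ _⟩ <;> module
    · obtain ⟨q, rfl⟩ : ∃ q', q = q' + 1 := ⟨q - 1, by omega⟩
      have hq' : q ≠ 0 := by
        rintro rfl
        exact h 1 (by simp)
      refine ⟨_, isMove_vec (hG.isMove_sub ?_) (.of_eq _ (congrArg _ ?_)) (.refl _ _) (.refl _ _),
        ih p q hp (by omega) (by omega) τ _ _ _⟩ <;> module
  · refine hG.copsWin_step outer (fun h => absurd rfl (h 2)) (fun h => absurd rfl (h 3)) ?_
    rwa [Bool.not_not]

/-- The other two cops squeeze the robber in his row. -/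
theorem copsWin_of_squeeze (hG : IsBicirculant G g P) {β : Bool} {p q : ℕ} (hp : 1 ≤ p)
    (hq : 1 ≤ q)
    (ih : ∀ p' q', 1 ≤ p' → 1 ≤ q' → p' + q' < p + q → GuardsWin G g P β p' q')
    (u w : ℕ) (hu : 1 ≤ u) (hw : 1 ≤ w) (τ : Bool) (x : A) :
    CopsWin G ![P τ (x + p • g β), P τ (x - q • g β), P (!β) (x + u • g (!β)),
      P (!β) (x - w • g (!β))] (P τ x) := by
  induction hN : u + w using Nat.strong_induction_on generalizing u w τ x with
  | _ N IH =>
  subst hN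
  by_cases h3 : 3 ≤ u + w
  · have closer : ∃ u' w', 1 ≤ u' ∧ 1 ≤ w' ∧ u' + w' < u + w ∧
        IsMove G (P (!β) (x + u • g (!β))) (P (!β) (x + u' • g (!β))) ∧
        IsMove G (P (!β) (x - w • g (!β))) (P (!β) (x - w' • g (!β))) := by
      by_cases hu' : 2 ≤ u
      · obtain ⟨u, rfl⟩ : ∃ u', u = u' + 1 := ⟨u - 1, by omega⟩
        refine ⟨u, w, by omega, hw, by omega, hG.isMove_sub ?_, .refl _ _⟩
        module
      · obtain ⟨w, rfl⟩ : ∃ w', w = w' + 1 := ⟨w - 1, by omega⟩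
        refine ⟨u, w, hu, by omega, by omega, .refl _ _, hG.isMove_add ?_⟩
        module
    obtain ⟨u', w', hu', hw', hlt, h₁, h₂⟩ := closer
    refine hG.copsWin_of_row hp hq ih ⟨_, _, h₁, h₂, IH _ hlt u' w' hu' hw' τ x rfl⟩ ?_ ?_
      ⟨_, _, h₁, h₂, IH _ hlt u' w' hu' hw' (!τ) x rfl⟩
    · rintro rfl h
      obtain ⟨u, rfl⟩ : ∃ u', u = u' + 1 := ⟨u - 1, by omega⟩
      have hu0 : u ≠ 0 := by
        rintro rfl
        exact h (by simp)
      refine ⟨_, _, .of_eq _ (congrArg _ ?_), hG.isMove_add ?_,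
        IH _ (by omega) u w (by omega) hw (!β) (x + g (!β)) rfl⟩ <;> module
    · rintro rfl h
      obtain ⟨w, rfl⟩ : ∃ w', w = w' + 1 := ⟨w - 1, by omega⟩
      have hw0 : w ≠ 0 := by
        rintro rfl
        exact h (by simp)
      refine ⟨_, _, hG.isMove_sub ?_, .of_eq _ (congrArg _ ?_),
        IH _ (by omega) u w hu (by omega) (!β) (x - g (!β)) rfl⟩ <;> module
  · obtain rfl : u = 1 := by omega
    obtain rfl : w = 1 := by omega
    simp only [one_smul]
    have blocked := hG.copsWin_of_blocked hp hq ih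
    rcases Bool.eq_or_eq_not τ β with rfl | rfl
    · exact blocked τ x
    · refine hG.copsWin_step ⟨_, isMove_vec (hG.isMove_not' rfl) (hG.isMove_not' rfl)
        (.refl _ _) (.refl _ _), blocked (!β) x⟩ (fun h => absurd rfl (h 2))
        (fun h => absurd rfl (h 3)) ⟨_, isMove_vec (hG.isMove_not' rfl) (hG.isMove_not' rfl)
        (.refl _ _) (.refl _ _), blocked (!!β) x⟩

/-- Within `m` moves a cop on `c` can get to a vertex of type `!β` in the row of `x`. -/
def ReachesRow (G : SimpleGraph V) (g : Bool → A) (P : Bool → A → V) (β : Bool) :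
    ℕ → V → A → Prop
  | 0, c, x => ∃ u : ℤ, c = P (!β) (x + u • g (!β))
  | m + 1, c, x => ∃ c', IsMove G c c' ∧ ReachesRow G g P β m c' x

theorem ReachesRow.mono {β : Bool} {m m' : ℕ} (hm : m ≤ m') {c : V} {x : A}
    (h : ReachesRow G g P β m c x) : ReachesRow G g P β m' c x := by
  induction hm with
  | refl => exact h
  | step _ ih => exact ⟨c, .refl _ _, ih⟩

/-- The row is a coset of the multiples of `g (!β)`, so the robber's moves within it do not delay an
approaching cop. -/
theorem ReachesRow.translate {β : Bool} {m : ℕ} {c : V} {x : A} (h : ReachesRow G g P β m c x)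
    (u : ℤ) : ReachesRow G g P β m c (x + u • g (!β)) := by
  induction m generalizing c with
  | zero =>
    obtain ⟨w, rfl⟩ := h
    refine ⟨w - u, congrArg _ ?_⟩
    module
  | succ m ih =>
    obtain ⟨c', hc', h⟩ := h
    exact ⟨c', hc', ih h⟩

theorem exists_reachesRow (hG : IsBicirculant G g P) (β : Bool) (c : V) (x : A) :
    ∃ m, ReachesRow G g P β m c x := by
  have key : ∀ (v u : ℕ), ReachesRow G g P β (v + 1) (P β (x + u • g (!β) + v • g β)) x := by
    intro v u
    induction v with
    | zero => exact ⟨_, hG.isMove_not rfl, u, by simp⟩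
    | succ v ih =>
      refine ⟨_, hG.isMove_sub ?_, ih⟩
      module
  obtain ⟨τ, y, rfl⟩ := hG.surj c
  obtain ⟨v, u, h⟩ := hG.span' β (y - x)
  obtain rfl : y = x + u • g (!β) + v • g β := by
    rw [eq_add_of_sub_eq h]
    module
  rcases Bool.eq_or_eq_not τ β with rfl | rfl
  · exact ⟨_, key v u⟩
  · exact ⟨v + 1 + 1, _, hG.isMove_not' rfl, key v u⟩

/-- In a finite group an axis is a cycle, so any cop on it counts as ahead or behind at a positive
distance, as needed. -/
theorem exists_nsmul_eq_zsmul [Finite A] (a : A) (u : ℤ) : ∃ w : ℕ, 1 ≤ w ∧ w • a = u • a := by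
  obtain ⟨N, hN, h⟩ := (isOfFinAddOrder_of_finite a).exists_nsmul_eq_zero
  have hN' : (0 : ℤ) < N := by exact_mod_cast hN
  have h0 : 0 ≤ u % N := Int.emod_nonneg _ hN'.ne'
  refine ⟨(u % N).toNat + N, by omega, ?_⟩
  rw [add_smul, h, add_zero, ← natCast_zsmul, Int.toNat_of_nonneg h0]
  conv_rhs => rw [← Int.emod_add_mul_ediv u N, add_smul, mul_comm, mul_smul, natCast_zsmul, h,
    smul_zero, add_zero]

/-- The outer induction is on the gap `p + q`, the inner one on the time the other two cops need to
reach the robber's row and start the squeeze. -/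
theorem guardsWin [Finite A] (hG : IsBicirculant G g P) (β : Bool) (p q : ℕ) (hp : 1 ≤ p)
    (hq : 1 ≤ q) : GuardsWin G g P β p q := by
  induction hN : p + q using Nat.strong_induction_on generalizing p q with
  | _ N IH =>
  subst hN
  have ih : ∀ p' q', 1 ≤ p' → 1 ≤ q' → p' + q' < p + q → GuardsWin G g P β p' q' :=
    fun p' q' hp' hq' hlt => IH _ hlt p' q' hp' hq' rfl
  intro τ x c d
  obtain ⟨m, hc⟩ := hG.exists_reachesRow β c x
  obtain ⟨m', hd⟩ := hG.exists_reachesRow β d x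
  replace hc := hc.mono (le_max_left m m')
  replace hd := hd.mono (le_max_right m m')
  generalize max m m' = l at hc hd
  induction l generalizing τ x c d with
  | zero =>
    obtain ⟨u, rfl⟩ := hc
    obtain ⟨w, rfl⟩ := hd
    obtain ⟨u', hu', hu⟩ := exists_nsmul_eq_zsmul (g (!β)) u
    obtain ⟨w', hw', hw⟩ := exists_nsmul_eq_zsmul (g (!β)) (-w)
    have := hG.copsWin_of_squeeze hp hq ih u' w' hu' hw' τ x
    rwa [hu, hw, neg_smul, sub_neg_eq_add] at this
  | succ l il =>
    obtain ⟨c', hcc, hc⟩ := hc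
    obtain ⟨d', hdd, hd⟩ := hd
    refine hG.copsWin_of_row hp hq ih ⟨c', d', hcc, hdd, il τ x _ _ hc hd⟩ ?_ ?_
      ⟨c', d', hcc, hdd, il (!τ) x _ _ hc hd⟩
    · rintro rfl -
      refine ⟨c', d', hcc, hdd, il _ _ _ _ ?_ ?_⟩
      · simpa using hc.translate 1
      · simpa using hd.translate 1
    · rintro rfl -
      refine ⟨c', d', hcc, hdd, il _ _ _ _ ?_ ?_⟩
      · simpa [sub_eq_add_neg] using hc.translate (-1)
      · simpa [sub_eq_add_neg] using hd.translate (-1)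

/-! ### Bringing cops onto the axes. -/

/-- The position `F` of the cops, with cop `i` put on `a` and cop `j` on `b`. -/
def placePair (i j : Fin m) (a b : V) (F : Fin m → V) : Fin m → V :=
  fun l => if l = i then a else if l = j then b else F l

theorem isMove_placePair (i j : Fin m) {a b a' b' : V} {F F' : Fin m → V} (ha : IsMove G a a')
    (hb : IsMove G b b') (hF : ∀ l, IsMove G (F l) (F' l)) (l : Fin m) :
    IsMove G (placePair i j a b F l) (placePair i j a' b' F' l) := by
  unfold placePair
  split_ifs
  exacts [ha, hb, hF l]

/-- Being a multiple of one of the two generators. -/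
def Axial (g : Bool → A) (z : A) : Prop := ∃ (τ : Bool) (u : ℤ), z = u • g τ

/-- Two cops can bring one of them to an axial position relative to the robber, while the others
copy the moves of the robber. -/
theorem copsWin_of_pair (hG : IsBicirculant G g P) {i j : Fin m} (E : Fin m → A)
    (H : ∀ τ x a b, Axial g a ∨ Axial g b →
      CopsWin G (placePair i j (P τ (x + a)) (P τ (x + b)) fun l => P τ (x + E l)) (P τ x))
    (u v u' v' : ℕ) (τ : Bool) (x : A) :
    CopsWin G (placePair i j (P τ (x + (u • g τ + v • g (!τ))))
      (P τ (x - (u' • g τ + v' • g (!τ)))) fun l => P τ (x + E l)) (P τ x) := by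
  induction hN : u + v + (u' + v') using Nat.strong_induction_on generalizing u v u' v' τ x with
  | _ N IH =>
  subst hN
  by_cases h : Axial g (u • g τ + v • g (!τ)) ∨ Axial g (-(u' • g τ + v' • g (!τ)))
  · simpa only [sub_eq_add_neg] using H τ x _ _ h
  rw [not_or] at h
  -- A vanishing coefficient would make a displacement axial, so each of the four can be lowered by
  -- one.
  obtain ⟨u, rfl⟩ : ∃ k, u = k + 1 := Nat.exists_eq_succ_of_ne_zero <| by
    rintro rfl
    exact h.1 ⟨!τ, v, by simp⟩
  obtain ⟨v, rfl⟩ : ∃ k, v = k + 1 := Nat.exists_eq_succ_of_ne_zero <| by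
    rintro rfl
    exact h.1 ⟨τ, (u + 1 : ℕ), by rw [natCast_zsmul]; simp⟩
  obtain ⟨u', rfl⟩ : ∃ k, u' = k + 1 := Nat.exists_eq_succ_of_ne_zero <| by
    rintro rfl
    exact h.2 ⟨!τ, -v', by simp⟩
  obtain ⟨v', rfl⟩ : ∃ k, v' = k + 1 := Nat.exists_eq_succ_of_ne_zero <| by
    rintro rfl
    exact h.2 ⟨τ, -(u' + 1 : ℕ), by rw [neg_smul, natCast_zsmul]; simp⟩
  have IHn : ∀ (a b a' b' : ℕ) (y : A), a + b + (a' + b') < u + 1 + (v + 1) + (u' + 1 + (v' + 1)) →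
      CopsWin G (placePair i j (P (!τ) (y + (b • g (!τ) + a • g τ)))
        (P (!τ) (y - (b' • g (!τ) + a' • g τ))) fun l => P (!τ) (y + E l)) (P (!τ) y) := by
    intro a b a' b' y hlt
    have := IH _ (by omega) b a b' a' (!τ) y rfl
    rwa [Bool.not_not] at this
  refine hG.copsWin_step ?_ (fun _ => ?_) (fun _ => ?_) ?_
  · refine ⟨_, isMove_placePair i j (hG.isMove_sub ?_) (.refl _ _) fun l => .refl _ _,
      IH _ (by omega) u (v + 1) (u' + 1) (v' + 1) τ x rfl⟩
    module
  · refine ⟨_, isMove_placePair i j (.of_eq _ (congrArg _ ?_)) (hG.isMove_add ?_)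
      fun l => hG.isMove_add ?_,
      IH _ (by omega) u (v + 1) (u' + 1) (v' + 1) τ (x + g τ) rfl⟩ <;> module
  · refine ⟨_, isMove_placePair i j (hG.isMove_sub ?_) (.of_eq _ (congrArg _ ?_))
      fun l => hG.isMove_sub ?_,
      IH _ (by omega) (u + 1) (v + 1) u' (v' + 1) τ (x - g τ) rfl⟩ <;> module
  -- Copying a spoke move gains nothing, so cop `i` keeps his type and gains a step along `g τ`. His
  -- type agrees with the robber's again after the next exchange.
  · refine ⟨placePair i j (P τ (x + (u • g τ + (v + 1) • g (!τ))))
      (P (!τ) (x - ((u' + 1) • g τ + (v' + 1) • g (!τ)))) fun l => P (!τ) (x + E l),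
      isMove_placePair i j (hG.isMove_sub ?_) (hG.isMove_not rfl) fun l => hG.isMove_not rfl,
      hG.copsWin_step ?_ (fun _ => ?_) (fun _ => ?_) ?_⟩
    · module
    · refine ⟨_, isMove_placePair i j (hG.isMove_not ?_) (.of_eq _ (congrArg _ ?_))
        fun l => .refl _ _, IHn u (v + 1) (u' + 1) (v' + 1) x (by omega)⟩ <;> module
    · refine ⟨_, isMove_placePair i j (hG.isMove_not ?_) (hG.isMove_add ?_)
        fun l => hG.isMove_add ?_,
        IHn u v (u' + 1) (v' + 1) (x + g (!τ)) (by omega)⟩ <;> module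
    -- Cop `i` spends his move on the spoke and loses a step along `g (!τ)`, but cop `j` gains one
    -- by waiting; the earlier gain in `u` keeps the total smaller.
    · refine ⟨_, isMove_placePair i j (hG.isMove_not ?_) (.of_eq _ (congrArg _ ?_))
        fun l => hG.isMove_sub ?_,
        IHn u (v + 2) (u' + 1) v' (x - g (!τ)) (by omega)⟩ <;> module
    · rw [Bool.not_not]
      refine ⟨_, isMove_placePair i j (.refl _ _) (hG.isMove_not' ?_)
        fun l => hG.isMove_not' rfl,
        IH _ (by omega) u (v + 1) (u' + 1) (v' + 1) τ x rfl⟩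
      module

theorem exists_perm {i j : Fin 4} (h : i ≠ j) : ∃ σ : Equiv.Perm (Fin 4), σ 0 = i ∧ σ 1 = j := by
  refine ⟨Equiv.swap 0 i * Equiv.swap 1 (Equiv.swap 0 i j), ?_, ?_⟩
  · revert i j
    decide
  · simp

/-- Two cops on the same axis of the robber suffice. -/
theorem copsWin_of_same_axis [Finite A] (hG : IsBicirculant G g P) {i j : Fin 4} (hij : i ≠ j)
    {D : Fin 4 → A} {β : Bool} {u w : ℤ} (hi : D i = u • g β) (hj : D j = w • g β) (τ : Bool)
    (x : A) : CopsWin G (fun l => P τ (x + D l)) (P τ x) := by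
  obtain ⟨σ, rfl, rfl⟩ := exists_perm hij
  obtain ⟨p, hp, hp'⟩ := exists_nsmul_eq_zsmul (g β) u
  obtain ⟨q, hq, hq'⟩ := exists_nsmul_eq_zsmul (g β) (-w)
  refine .of_comp_perm σ ?_
  convert hG.guardsWin β p q hp hq τ x (P τ (x + D (σ 2))) (P τ (x + D (σ 3))) using 1
  ext l
  fin_cases l
  · simp [hi, hp']
  · simp [hj, hq', sub_eq_add_neg]
  · rfl
  · rfl

open Classical in
-- While two cops are off the axes, they form a pair and one of them becomes axial. The others copy
-- the robber and keep their displacements, so the number of non-axial cops drops.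
theorem copsWin_of_sync [Finite A] (hG : IsBicirculant G g P) (D : Fin 4 → A) (τ : Bool) (x : A) :
    CopsWin G (fun l => P τ (x + D l)) (P τ x) := by
  induction hN : (Finset.univ.filter fun l => ¬ Axial g (D l)).card using Nat.strong_induction_on
    generalizing D τ x with
  | _ N IH =>
  subst hN
  by_cases h : ∃ i j, i ≠ j ∧ ¬ Axial g (D i) ∧ ¬ Axial g (D j)
  · obtain ⟨i, j, hij, hi, hj⟩ := h
    obtain ⟨u, v, huv⟩ := hG.span' τ (D i)
    obtain ⟨u', v', huv'⟩ := hG.span' τ (-D j)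
    have heq : ∀ τ x (a b : A),
        (placePair i j (P τ (x + a)) (P τ (x + b)) fun l => P τ (x + D l)) =
          fun l => P τ (x + if l = i then a else if l = j then b else D l) := by
      intro τ x a b
      ext l
      unfold placePair
      split_ifs <;> rfl
    have := hG.copsWin_of_pair (i := i) (j := j) D (fun τ x a b hab => ?_) u v u' v' τ x
    · rw [← huv, ← huv', sub_neg_eq_add, heq] at this
      convert this using 5 with l
      split_ifs with h₁ h₂
      exacts [h₁ ▸ rfl, h₂ ▸ rfl, rfl]
    · rw [heq]
      refine IH _ (Finset.card_lt_card ?_) _ τ x rfl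
      rw [Finset.ssubset_iff_of_subset]
      · rcases hab with ha | hb
        · exact ⟨i, by simpa using hi, by simpa using ha⟩
        · exact ⟨j, by simpa using hj, by simpa [hij.symm] using hb⟩
      · intro l hl
        rw [Finset.mem_filter] at hl ⊢
        refine ⟨Finset.mem_univ l, ?_⟩
        by_cases h₁ : l = i
        · exact h₁ ▸ hi
        by_cases h₂ : l = j
        · exact h₂ ▸ hj
        simpa [h₁, h₂] using hl.2
  · have hax : ∃ i, ∀ l, l ≠ i → Axial g (D l) := by
      by_cases h' : ∃ i, ¬ Axial g (D i)
      · obtain ⟨i, hi⟩ := h'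
        exact ⟨i, fun l hl => by_contra fun hl' => h ⟨i, l, hl.symm, hi, hl'⟩⟩
      · exact ⟨0, fun l _ => by_contra fun hl => h' ⟨l, hl⟩⟩
    obtain ⟨i, hi⟩ := hax
    choose T U hTU using hi
    -- Pigeonhole: three axial cops, two axes.
    have hcard : Fintype.card Bool < Fintype.card {l : Fin 4 // l ≠ i} := by simp
    obtain ⟨a, b, hab, hT⟩ := Fintype.exists_ne_map_eq_of_card_lt
      (fun l : {l : Fin 4 // l ≠ i} => T l l.2) hcard
    have hb := hTU b b.2
    rw [← hT] at hb
    exact hG.copsWin_of_same_axis (fun hab' => hab (Subtype.ext hab')) (hTU a a.2) hb τ x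

theorem exists_isWinning_four [Finite A] (hG : IsBicirculant G g P) :
    ∃ s : CopStrategy G 4, s.IsWinning := by
  -- All cops start together; their first move only matches the robber's type.
  refine exists_isWinning (fun _ => P true 0) fun r₀ => ?_
  obtain ⟨τ, x, rfl⟩ := hG.surj r₀
  have hw := hG.copsWin_of_sync (fun _ => -x) τ x
  rw [add_neg_cancel] at hw
  refine ⟨_, fun _ => ?_, hw⟩
  cases τ
  · exact hG.move_not true 0
  · exact .refl _ _

end IsBicirculant

/-! ### Generalised Petersen graphs. -/

/-- The vertices `a_x` and `b_x` of a generalised Petersen graph. -/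
def petersenVertex (n : ℕ) : Bool → ZMod n → ZMod n ⊕ ZMod n
  | true, x => Sum.inl x
  | false, x => Sum.inr x

/-- The differences of adjacent outer vertices and of adjacent inner vertices. -/
def petersenStep (n k : ℕ) : Bool → ZMod n
  | true => 1
  | false => k

theorem isBicirculant_generalizedPetersen (n k : ℕ) [NeZero n] :
    IsBicirculant (generalizedPetersen n k) (petersenStep n k) (petersenVertex n) where
  surj
    | Sum.inl x => ⟨true, x, rfl⟩
    | Sum.inr x => ⟨false, x, rfl⟩
  move_add τ x := by
    refine or_iff_not_imp_left.2 fun h => (SimpleGraph.fromRel_adj _ _ _).2 ⟨Ne.symm h, .inl ?_⟩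
    cases τ <;> rfl
  move_sub τ x := by
    refine or_iff_not_imp_left.2 fun h => (SimpleGraph.fromRel_adj _ _ _).2 ⟨Ne.symm h, .inr ?_⟩
    cases τ <;> exact (sub_add_cancel _ _).symm
  move_not τ x := by
    refine .inr ((SimpleGraph.fromRel_adj _ _ _).2 ⟨?_, ?_⟩)
    · cases τ <;> simp [petersenVertex]
    · cases τ
      · exact .inr rfl
      · exact .inl rfl
  adj τ x v h := by
    obtain ⟨-, h⟩ := (SimpleGraph.fromRel_adj _ _ _).1 h
    cases τ <;> rcases v with y | y <;>
      simp only [petersenVertex, petersenStep, generalizedPetersenArc, Bool.not_true,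
        Bool.not_false, Sum.inl.injEq, Sum.inr.injEq, reduceCtorEq, eq_sub_iff_add_eq] at h ⊢ <;>
      grind
  -- The outer step 1 alone generates `ZMod n`.
  span x := ⟨x.val, 0, by simp [petersenStep]⟩

end SurroundingCops

theorem mainTheorem9 (n k : ℕ) (hn : 5 ≤ n) (hk : 2 ≤ k) (hnk : 2 * k < n) :
    SurroundingCops.surroundingCopNumber (generalizedPetersen n k) ≤ 4 := by
  have : NeZero n := ⟨by omega⟩
  exact iInf₂_le_of_le 4 ⟨by norm_num,
    (SurroundingCops.isBicirculant_generalizedPetersen n k).exists_isWinning_four⟩ le_rfl
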